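/- For a finite set $A$, let $F(A)$ be the free group and $\widehat{F}(A)$ the free profinite group on $A$, and let $\widehat{\phi}$ denote the unique continuous endomorphism of $\widehat{F}(A)$ extending $\phi\in\mathrm{End}(F(A))$. For a continuous endomorphism $\psi$ of $\widehat{F}(A)$, let $\psi^\omega$ be the unique idempotent in the closure of $\{\psi^n : n\ge 1\}$ in the monoid of continuous endomorphisms of $\widehat{F}(A)$ with the compact-open topology. We say that $\phi\in\mathrm{End}(F(A))$ defines an $\omega$-presentation of a profinite group $G$, with $|A|$ generators, if $G$ is isomorphic, as a topological group, to $\widehat{F}(A)/N$, where $N$ is the closed normal subgroup of $\widehat{F}(A)$ generated by $\{\widehat{\phi}^{\omega}(a)a^{-1} : a\in A\}$. An endomorphism of a group $H$ that is free on a finite subset $B\subseteq H$ is regarded as an endomorphism of $F(B)$ through the identification $H=F(B)$. Let $A$ be a finite set and suppose that $\phi\in\mathrm{End}(F(A))$ defines an $\omega$-presentation of a profinite group $G$. Let $n\ge 0$ be an integer. Then the subgroup $\mathrm{im}(\phi^n)$ of $F(A)$ is free, and for every free basis $B$ of $\mathrm{im}(\phi^n)$, the set $B$ is finite with $|B|\le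 |A|$, and the restriction of $\phi$ to an endomorphism of $\mathrm{im}(\phi^n)=F(B)$ defines an $\omega$-presentation of $G$ (with $|B|$ generators). -/

import Mathlib

universe u w

/-- The free profinite group on `A`, realized as the profinite completion of the free group
on `A`. -/
noncomputable abbrev FreeProfiniteGroup (A : Type u) : ProfiniteGrp.{u} :=
  ProfiniteGrp.ProfiniteCompletion.completion (GrpCat.of (FreeGroup A))

namespace FreeProfiniteGroup

/-- The canonical homomorphism from the free group to the free profinite group. -/
noncomputable def ofFree (A : Type u) : FreeGroup A →* FreeProfiniteGroup A :=
  (ProfiniteGrp.ProfiniteCompletion.eta (GrpCat.of (FreeGroup A))).hom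

/-- The free generator of the free profinite group attached to a letter. -/
noncomputable def of {A : Type u} (a : A) : FreeProfiniteGroup A :=
  ofFree A (FreeGroup.of a)

/-- The profinite extension of an endomorphism `φ` of the free group: the continuous
endomorphism of the free profinite group induced by `φ`. -/
noncomputable def extend {A : Type u} (φ : Monoid.End (FreeGroup A)) :
    FreeProfiniteGroup A →ₜ* FreeProfiniteGroup A :=
  (ProfiniteGrp.profiniteCompletion.map (GrpCat.ofHom φ)).hom

theorem extend_ofFree {A : Type u} (φ : Monoid.End (FreeGroup A)) (x : FreeGroup A) :
    extend φ (ofFree A x) = ofFree A (φ x) :=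
  CategoryTheory.ConcreteCategory.congr_hom
    (ProfiniteGrp.ProfiniteCompletion.lift_eta
      (CategoryTheory.CategoryStruct.comp (GrpCat.ofHom φ)
        (ProfiniteGrp.ProfiniteCompletion.eta (GrpCat.of (FreeGroup A))))) x

end FreeProfiniteGroup

/-- `e` is the `ω`-power of the continuous endomorphism `ψ`: it is an idempotent lying in the
closure, for the compact-open topology, of the set of positive powers `ψ ^ n`, `n ≥ 1`, under
composition. (The power `n = 0` is left out: it is the identity, which is always idempotent.) -/
def IsOmegaPower {P : Type u} [Group P] [TopologicalSpace P] (ψ e : P →ₜ* P) : Prop :=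
  e.comp e = e ∧ e ∈ closure {f : P →ₜ* P | ∃ n : ℕ, 1 ≤ n ∧ ⇑f = (⇑ψ)^[n]}

/-- The closed normal subgroup generated by a subset of a topological group. -/
def closedNormalClosure {P : Type u} [Group P] [TopologicalSpace P] [IsTopologicalGroup P]
    (R : Set P) : Subgroup P :=
  (Subgroup.normalClosure R).topologicalClosure

instance closedNormalClosure_normal {P : Type u} [Group P] [TopologicalSpace P]
    [IsTopologicalGroup P] (R : Set P) : (closedNormalClosure R).Normal :=
  Subgroup.is_normal_topologicalClosure _

/-- `(A, R)` is a profinite presentation of `G`: as a topological group, `G` is isomorphic to the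
quotient of the free profinite group on `A` by the closed normal subgroup generated by `R`. -/
def IsProfinitePresentation (G : ProfiniteGrp.{w}) (A : Type u)
    (R : Set (FreeProfiniteGroup A)) : Prop :=
  Nonempty (G ≃ₜ* (FreeProfiniteGroup A ⧸ closedNormalClosure R))

/-- The endomorphism `φ` of the free group on the finite set `A` defines an `ω`-presentation
of `G`. -/
def DefinesOmegaPresentation (G : ProfiniteGrp.{w}) {A : Type u}
    (φ : Monoid.End (FreeGroup A)) : Prop :=
  Finite A ∧ ∃ e : FreeProfiniteGroup A →ₜ* FreeProfiniteGroup A,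
    IsOmegaPower (FreeProfiniteGroup.extend φ) e ∧
    IsProfinitePresentation G A
      (Set.range fun a : A => e (FreeProfiniteGroup.of a) * (FreeProfiniteGroup.of a)⁻¹)

/-- The image of the `n`-th power of an endomorphism. -/
def imPow {F : Type u} [Group F] (φ : Monoid.End F) (n : ℕ) : Subgroup F :=
  MonoidHom.range (φ ^ n : Monoid.End F)

theorem apply_mem_imPow {F : Type u} [Group F] (φ : Monoid.End F) (n : ℕ) {x : F}
    (hx : x ∈ imPow φ n) : φ x ∈ imPow φ n := by
  obtain ⟨y, rfl⟩ := hx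
  refine ⟨φ y, ?_⟩
  change (φ ^ n * φ) y = (φ * φ ^ n) y
  rw [← pow_succ, ← pow_succ']

/-- The restriction of `φ` to an endomorphism of the image of `φ ^ n`. -/
def restrictImPow {F : Type u} [Group F] (φ : Monoid.End F) (n : ℕ) :
    Monoid.End (imPow φ n) where
  toFun x := ⟨φ (x : F), apply_mem_imPow φ n x.2⟩
  map_one' := Subtype.ext (map_one φ)
  map_mul' x y := Subtype.ext (map_mul φ (x : F) (y : F))

/-- An endomorphism of a group `H` with free basis `b : B → H`, written in that basis, that is, as
an endomorphism of the free group on `B`. -/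
def endInBasis {B H : Type u} [Group H] (b : FreeGroupBasis B H) (θ : Monoid.End H) :
    Monoid.End (FreeGroup B) :=
  (b.repr.toMonoidHom.comp θ).comp b.repr.symm.toMonoidHom

open Filter Topology

/-! Factor `φ ^ n` as `i ∘ p` with `p : F(A) → F(B)` onto; `p` intertwines `φ` with its restriction
`θ`. On profinite completions `p'` is still onto and `i' ∘ p'` is the `n`-th iterate of the extended
`φ`, so `ker p'` lies in the kernel of that iterate, hence in `ker e` (`apply_eq_one_of_iterate`).
Thus `e` descends along `p'` to some `e'`, which is the `ω`-power of the extended `θ`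
(`of_semiconj`). The relators of an idempotent generate its kernel (`closedNormalClosure_eq_ker`),
and `ker e` is the preimage of `ker e'` under `p'`, so the two quotients agree. Freeness is
Nielsen–Schreier; the rank bound comes from counting homomorphisms to `ℤ/2`. -/

theorem exists_continuousMonoidHom_coe_eq_iterate {P : Type*} [Group P] [TopologicalSpace P]
    (ψ : P →ₜ* P) (m : ℕ) : ∃ g : P →ₜ* P, ⇑g = (⇑ψ)^[m] := by
  induction m with
  | zero => exact ⟨.id P, rfl⟩
  | succ m ih =>
    obtain ⟨g, hg⟩ := ih
    exact ⟨g.comp ψ, by rw [ContinuousMonoidHom.coe_comp, hg, Function.iterate_succ]⟩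

/-- A continuous homomorphism out of a compact group factors through every continuous surjection
onto a Hausdorff group whose kernel it kills. -/
theorem exists_continuousMonoidHom_comp_eq {P Q R : Type*} [Group P] [TopologicalSpace P]
    [CompactSpace P] [Group Q] [TopologicalSpace Q] [T2Space Q] [Group R] [TopologicalSpace R]
    (p : P →ₜ* Q) (hp : Function.Surjective p) (f : P →ₜ* R) (hf : ∀ x, p x = 1 → f x = 1) :
    ∃ g : Q →ₜ* R, ∀ x, g (p x) = f x := by
  have hle : p.toMonoidHom.ker ≤ f.toMonoidHom.ker := fun x hx => hf x hx
  let g : Q →* R := p.toMonoidHom.liftOfSurjective hp ⟨f.toMonoidHom, hle⟩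
  have hg : ∀ x, g (p x) = f x := fun x =>
    p.toMonoidHom.liftOfRightInverse_comp_apply _ (Function.rightInverse_surjInv hp)
      ⟨f.toMonoidHom, hle⟩ x
  have hq : IsQuotientMap p :=
    p.continuous_toFun.isClosedMap.isQuotientMap p.continuous_toFun hp
  refine ⟨⟨g, hq.continuous_iff.2 ?_⟩, hg⟩
  exact f.continuous_toFun.congr fun x => (hg x).symm

namespace IsOmegaPower

variable {P Q : Type u} [Group P] [TopologicalSpace P] [Group Q] [TopologicalSpace Q]
  {ψ e : P →ₜ* P}

theorem apply_apply (h : IsOmegaPower ψ e) (x : P) : e (e x) = e x :=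
  DFunLike.congr_fun h.1 x

/-- The `ω`-power kills whatever is killed by some power. -/
theorem apply_eq_one_of_iterate [LocallyCompactSpace P] [T1Space P] (h : IsOmegaPower ψ e)
    {n : ℕ} {x : P} (hx : (⇑ψ)^[n] x = 1) : e x = 1 := by
  -- Map and argument both vary with `f`, so joint continuity of evaluation is needed, hence local
  -- compactness.
  have hcont : ∀ k : ℕ, Continuous fun f : P →ₜ* P => (⇑f)^[k] x := by
    intro k
    induction k with
    | zero => exact continuous_const
    | succ k ih =>
      simp only [Function.iterate_succ_apply']
      exact continuous_id.eval ih
  have hclosed : IsClosed {f : P →ₜ* P | (⇑f)^[n] x = 1} :=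
    isClosed_singleton.preimage (hcont n)
  -- This is where `m ≥ 1` matters: the `n`-th iterate of `ψ ^ m` is `ψ ^ (m * n)`, which passes
  -- through `ψ ^ n`.
  have hsub : {f : P →ₜ* P | ∃ m : ℕ, 1 ≤ m ∧ ⇑f = (⇑ψ)^[m]} ⊆ {f | (⇑f)^[n] x = 1} := by
    rintro f ⟨m, hm, hf⟩
    obtain ⟨k, rfl⟩ := Nat.exists_eq_add_of_le' hm
    have hone : ∀ j : ℕ, (⇑ψ)^[j] 1 = 1 := fun j => iterate_map_one ψ j
    change (⇑f)^[n] x = 1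
    rw [hf, ← Function.iterate_mul, add_mul, one_mul, Function.iterate_add_apply, hx, hone]
  have he : (⇑e)^[n] x = 1 := closure_minimal hsub hclosed h.2
  cases n with
  | zero => rw [show x = 1 from he, map_one]
  | succ k =>
    have : ∀ j : ℕ, (⇑e)^[j] (e x) = e x := fun j => Function.iterate_fixed (h.apply_apply x) j
    rwa [Function.iterate_succ_apply, this] at he

/-- `ω`-powers pass to quotients. -/
theorem of_semiconj [CompactSpace P] [T2Space Q] (h : IsOmegaPower ψ e) (p : P →ₜ* Q)
    (hp : Function.Surjective p) {ψ' e' : Q →ₜ* Q} (hψ : ∀ x, ψ' (p x) = p (ψ x))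
    (he : ∀ x, e' (p x) = p (e x)) : IsOmegaPower ψ' e' := by
  refine ⟨ContinuousMonoidHom.ext fun y => ?_, ?_⟩
  · obtain ⟨x, rfl⟩ := hp y
    change e' (e' (p x)) = e' (p x)
    rw [he, he, h.apply_apply]
  set S : Set (P →ₜ* P) := {f | ∃ m : ℕ, 1 ≤ m ∧ ⇑f = (⇑ψ)^[m]}
  have hne : NeBot (comap ((↑) : S → P →ₜ* P) (𝓝 e)) := mem_closure_iff_comap_neBot.1 h.2
  have hex : ∀ s : S, ∃ g : Q →ₜ* Q, (∃ m : ℕ, 1 ≤ m ∧ ⇑g = (⇑ψ')^[m]) ∧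
      ∀ x, g (p x) = p (s.1 x) := by
    rintro ⟨f, m, hm, hf⟩
    obtain ⟨g, hg⟩ := exists_continuousMonoidHom_coe_eq_iterate ψ' m
    refine ⟨g, ⟨m, hm, hg⟩, fun x => ?_⟩
    have hsemi : Function.Semiconj p ψ ψ' := fun x => (hψ x).symm
    rw [hg, hf]
    exact (hsemi.iterate_right m x).symm
  choose g hgS hg using hex
  -- Powers of `ψ` tending to `e` descend to powers of `ψ'`; these are shown to tend to `e'`.
  refine mem_closure_of_tendsto (f := g) (b := comap ((↑) : S → P →ₜ* P) (𝓝 e)) ?_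
    (Eventually.of_forall hgS)
  rw [(ContinuousMonoidHom.isInducing_toContinuousMap Q Q).tendsto_nhds_iff,
    ContinuousMap.tendsto_nhds_compactOpen]
  intro K hK U hU hKU
  have hlim : Tendsto (fun s : S => (s.1 : P →ₜ* P).toContinuousMap)
      (comap ((↑) : S → P →ₜ* P) (𝓝 e)) (𝓝 e.toContinuousMap) :=
    ((ContinuousMonoidHom.isInducing_toContinuousMap P P).continuous.tendsto e).comp
      tendsto_comap
  have hmaps : Set.MapsTo e.toContinuousMap (p ⁻¹' K) (p ⁻¹' U) := fun x hx => by
    have := hKU hx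
    change e' (p x) ∈ U at this
    rwa [he] at this
  -- Compactness of `P` makes `p ⁻¹' K` compact, so convergence to `e` can be tested on it.
  filter_upwards [ContinuousMap.tendsto_nhds_compactOpen.1 hlim _
    (hK.isClosed.preimage p.continuous_toFun).isCompact _ (hU.preimage p.continuous_toFun) hmaps]
    with s hs y hy
  obtain ⟨x, rfl⟩ := hp y
  have : p (s.1 x) ∈ U := hs hy
  change g s (p x) ∈ U
  rwa [hg]

end IsOmegaPower

namespace FreeProfiniteGroup

theorem denseRange_ofFree (A : Type u) : DenseRange (ofFree A) :=
  ProfiniteGrp.ProfiniteCompletion.denseRange (GrpCat.of (FreeGroup A))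

/-- The continuous homomorphism of free profinite groups induced by a homomorphism of free
groups. -/
noncomputable def map {A B : Type u} (f : FreeGroup A →* FreeGroup B) :
    FreeProfiniteGroup A →ₜ* FreeProfiniteGroup B :=
  (ProfiniteGrp.profiniteCompletion.map (GrpCat.ofHom f)).hom

theorem map_ofFree {A B : Type u} (f : FreeGroup A →* FreeGroup B) (x : FreeGroup A) :
    map f (ofFree A x) = ofFree B (f x) :=
  CategoryTheory.ConcreteCategory.congr_hom
    (ProfiniteGrp.ProfiniteCompletion.lift_eta
      (CategoryTheory.CategoryStruct.comp (GrpCat.ofHom f)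
        (ProfiniteGrp.ProfiniteCompletion.eta (GrpCat.of (FreeGroup B))))) x

theorem ext_of_ofFree {A X : Type*} [TopologicalSpace X] [T2Space X]
    {f g : FreeProfiniteGroup A → X} (hf : Continuous f) (hg : Continuous g)
    (h : ∀ x, f (ofFree A x) = g (ofFree A x)) (y : FreeProfiniteGroup A) : f y = g y :=
  congrFun ((denseRange_ofFree A).equalizer hf hg (funext h)) y

theorem map_surjective {A B : Type u} {f : FreeGroup A →* FreeGroup B}
    (hf : Function.Surjective f) : Function.Surjective (map f) := by
  have hclosed : IsClosed (Set.range (map f)) :=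
    (isCompact_range (map f).continuous_toFun).isClosed
  rw [← Set.range_eq_univ, ← hclosed.closure_eq, ← Set.univ_subset_iff]
  refine ((denseRange_ofFree B).closure_eq).ge.trans (closure_mono ?_)
  rintro _ ⟨y, rfl⟩
  obtain ⟨x, rfl⟩ := hf y
  exact ⟨ofFree A x, map_ofFree f x⟩

theorem iterate_extend_ofFree {A : Type u} (φ : Monoid.End (FreeGroup A)) (n : ℕ)
    (x : FreeGroup A) : (⇑(extend φ))^[n] (ofFree A x) = ofFree A ((φ ^ n) x) := by
  induction n generalizing x with
  | zero => rfl
  | succ n ih =>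
    rw [Function.iterate_succ_apply, extend_ofFree, ih, pow_succ]
    rfl

/-- The closed normal subgroup generated by the relators `e(a)a⁻¹` of a continuous idempotent
endomorphism `e` is the kernel of `e`. -/
theorem closedNormalClosure_eq_ker {A : Type u}
    (e : FreeProfiniteGroup A →ₜ* FreeProfiniteGroup A) (he : ∀ x, e (e x) = e x) :
    closedNormalClosure (Set.range fun a : A => e (of a) * (of a)⁻¹) = e.toMonoidHom.ker := by
  set N := closedNormalClosure (Set.range fun a : A => e (of a) * (of a)⁻¹)
  apply le_antisymm
  · refine Subgroup.topologicalClosure_minimal _ (Subgroup.normalClosure_le_normal ?_) ?_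
    · rintro _ ⟨a, rfl⟩
      change e (e (of a) * (of a)⁻¹) = 1
      rw [map_mul, map_inv, he, mul_inv_cancel]
    · exact isClosed_singleton.preimage e.continuous_toFun
  · have hNclosed : IsClosed (N : Set (FreeProfiniteGroup A)) :=
      Subgroup.isClosed_topologicalClosure _
    let q : FreeProfiniteGroup A →* FreeProfiniteGroup A ⧸ N := QuotientGroup.mk' N
    have hq : Continuous q := QuotientGroup.continuous_mk
    -- Modulo `N`, `e` and the identity agree on generators, hence everywhere by density; so `ker e`
    -- dies in the quotient.
    have hfree : (q.comp e.toMonoidHom).comp (ofFree A) = q.comp (ofFree A) := by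
      ext a
      have hmem : e (of a) * (of a)⁻¹ ∈ N :=
        Subgroup.le_topologicalClosure _ (Subgroup.subset_normalClosure ⟨a, rfl⟩)
      have h1 : q (e (of a) * (of a)⁻¹) = 1 := (QuotientGroup.eq_one_iff _).2 hmem
      rw [map_mul, map_inv, mul_inv_eq_one] at h1
      exact h1
    have hall : ∀ y, q (e y) = q y :=
      ext_of_ofFree (hq.comp e.continuous_toFun) hq fun x => DFunLike.congr_fun hfree x
    intro x hx
    have hx' : e x = 1 := hx
    refine (QuotientGroup.eq_one_iff x).1 ?_
    change q x = 1
    rw [← hall, hx', map_one]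

end FreeProfiniteGroup

/-- A surjective homomorphism of compact groups induces an isomorphism of the quotients by
a closed normal subgroup and its preimage. -/
theorem nonempty_quotient_continuousMulEquiv {P Q : Type*} [Group P] [TopologicalSpace P]
    [IsTopologicalGroup P] [CompactSpace P] [Group Q] [TopologicalSpace Q] [IsTopologicalGroup Q]
    (p : P →ₜ* Q) (hp : Function.Surjective p) (M : Subgroup P) [M.Normal] (N : Subgroup Q)
    [N.Normal] (hN : IsClosed (N : Set Q)) (hM : ∀ x, x ∈ M ↔ p x ∈ N) :
    Nonempty ((P ⧸ M) ≃ₜ* (Q ⧸ N)) := by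
  let f : P ⧸ M →* Q ⧸ N := QuotientGroup.map M N p.toMonoidHom fun x hx => (hM x).1 hx
  have hf : Continuous f :=
    continuous_quot_lift _ (QuotientGroup.continuous_mk.comp p.continuous_toFun)
  have hinj : Function.Injective f := by
    rw [injective_iff_map_eq_one]
    intro x
    induction x using QuotientGroup.induction_on with
    | H x =>
      intro hx
      exact (QuotientGroup.eq_one_iff x).2 ((hM x).2 ((QuotientGroup.eq_one_iff (p x)).1 hx))
  have hsurj : Function.Surjective f := by
    intro y
    induction y using QuotientGroup.induction_on with
    | H y =>
      obtain ⟨x, rfl⟩ := hp y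
      exact ⟨(x : P ⧸ M), rfl⟩
  let E : P ⧸ M ≃* Q ⧸ N := MulEquiv.ofBijective f ⟨hinj, hsurj⟩
  exact ⟨{ E with
    continuous_toFun := hf
    continuous_invFun := hf.continuous_symm_of_equiv_compact_to_t2 (f := E.toEquiv) }⟩

/-- A quotient of a free group of finite rank that is itself free has no larger rank. -/
theorem FreeGroup.finite_and_card_le_of_surjective {A B : Type*} [Finite A]
    (f : FreeGroup A →* FreeGroup B) (hf : Function.Surjective f) :
    Finite B ∧ Nat.card B ≤ Nat.card A := by
  -- Homomorphisms from a free group to `ℤ/2` are functions on its basis, and precomposition with a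
  -- surjection is injective, so `2 ^ |B| ≤ 2 ^ |A|`.
  let C := Multiplicative (ZMod 2)
  let r : (B → C) → (A → C) := fun g => FreeGroup.lift.symm ((FreeGroup.lift g).comp f)
  have hr : Function.Injective r := by
    intro g g' h
    refine FreeGroup.lift.injective ?_
    exact (MonoidHom.cancel_right hf).1 (FreeGroup.lift.symm.injective h)
  have hC : Nat.card C = 2 := by simp [C]
  have : Finite (B → C) := Finite.of_injective r hr
  have hB : Finite B := by
    classical
    refine Finite.of_injective (fun b : B => (Function.update 1 b (.ofAdd 1) : B → C))
      fun b b' h => ?_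
    by_contra hne
    have := congrFun h b
    simp [Function.update_of_ne hne, C] at this
  refine ⟨hB, ?_⟩
  have hle := Nat.card_le_card_of_injective r hr
  rw [Nat.card_fun, Nat.card_fun, hC] at hle
  exact (Nat.pow_le_pow_iff_right one_lt_two).1 hle

/-- The subgroup `im (φ ^ n)` has a free basis, and in whichever free basis `B` the restriction of
`φ` to it is written, this restriction defines an `ω`-presentation of `G`, with `|B| ≤ |A|`
generators. -/
theorem proposition3p2 {A : Type u} (φ : Monoid.End (FreeGroup A)) (G : ProfiniteGrp.{w})
    (hφ : DefinesOmegaPresentation G φ) (n : ℕ) :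
    (∃ B : Type u, Nonempty (FreeGroupBasis B (imPow φ n))) ∧
    ∀ (B : Type u) (b : FreeGroupBasis B (imPow φ n)),
      DefinesOmegaPresentation G (endInBasis b (restrictImPow φ n)) ∧
      Nat.card B ≤ Nat.card A := by
  refine ⟨IsFreeGroup.nonempty_basis, fun B b => ?_⟩
  obtain ⟨hA, e, he, ⟨γ⟩⟩ := hφ
  let r : FreeGroup A →* imPow φ n := MonoidHom.rangeRestrict (φ ^ n : Monoid.End (FreeGroup A))
  let p : FreeGroup A →* FreeGroup B := b.repr.toMonoidHom.comp r
  let i : FreeGroup B →* FreeGroup A := (imPow φ n).subtype.comp b.repr.symm.toMonoidHom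
  have hp : Function.Surjective p :=
    b.repr.surjective.comp (MonoidHom.rangeRestrict_surjective _)
  have hip : ∀ x, i (p x) = (φ ^ n) x := fun x =>
    congrArg Subtype.val (b.repr.symm_apply_apply (r x))
  set θ := endInBasis b (restrictImPow φ n)
  have hθp : ∀ x, θ (p x) = p (φ x) := by
    intro x
    change b.repr (restrictImPow φ n (b.repr.symm (b.repr (r x)))) = b.repr (r (φ x))
    rw [b.repr.symm_apply_apply]
    refine congrArg b.repr (Subtype.ext ?_)
    change (φ * φ ^ n) x = (φ ^ n * φ) x
    rw [← pow_succ, ← pow_succ']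
  obtain ⟨hB, hcard⟩ := FreeGroup.finite_and_card_le_of_surjective p hp
  let p' := FreeProfiniteGroup.map p
  let i' := FreeProfiniteGroup.map i
  have hp' : Function.Surjective p' := FreeProfiniteGroup.map_surjective hp
  have hip' : ∀ x, i' (p' x) = (⇑(FreeProfiniteGroup.extend φ))^[n] x :=
    FreeProfiniteGroup.ext_of_ofFree (i'.continuous_toFun.comp p'.continuous_toFun)
      ((FreeProfiniteGroup.extend φ).continuous_toFun.iterate n) fun x => by
        rw [FreeProfiniteGroup.map_ofFree, FreeProfiniteGroup.map_ofFree, hip,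
          FreeProfiniteGroup.iterate_extend_ofFree]
  have hθp' : ∀ x, FreeProfiniteGroup.extend θ (p' x) = p' (FreeProfiniteGroup.extend φ x) :=
    FreeProfiniteGroup.ext_of_ofFree
      ((FreeProfiniteGroup.extend θ).continuous_toFun.comp p'.continuous_toFun)
      (p'.continuous_toFun.comp (FreeProfiniteGroup.extend φ).continuous_toFun) fun x => by
        rw [FreeProfiniteGroup.map_ofFree, FreeProfiniteGroup.extend_ofFree,
          FreeProfiniteGroup.extend_ofFree, FreeProfiniteGroup.map_ofFree, hθp]
  have hker : ∀ x, p' x = 1 → e x = 1 := fun x hx =>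
    he.apply_eq_one_of_iterate (n := n) (by rw [← hip', hx, map_one])
  obtain ⟨e', he'⟩ := exists_continuousMonoidHom_comp_eq p' hp' (p'.comp e) fun x hx => by
    change p' (e x) = 1
    rw [hker x hx, map_one]
  have hω : IsOmegaPower (FreeProfiniteGroup.extend θ) e' := he.of_semiconj p' hp' hθp' he'
  refine ⟨⟨hB, e', hω, ?_⟩, hcard⟩
  obtain ⟨δ⟩ := nonempty_quotient_continuousMulEquiv p' hp'
    (closedNormalClosure (Set.range fun a : A =>
      e (FreeProfiniteGroup.of a) * (FreeProfiniteGroup.of a)⁻¹))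
    (closedNormalClosure (Set.range fun a : B =>
      e' (FreeProfiniteGroup.of a) * (FreeProfiniteGroup.of a)⁻¹))
    (Subgroup.isClosed_topologicalClosure _) fun x => by
      rw [FreeProfiniteGroup.closedNormalClosure_eq_ker e he.apply_apply,
        FreeProfiniteGroup.closedNormalClosure_eq_ker e' hω.apply_apply]
      change e x = 1 ↔ e' (p' x) = 1
      rw [he']
      change e x = 1 ↔ p' (e x) = 1
      -- Conversely, `e x ∈ ker p' ⊆ ker e` gives `e x = e (e x) = 1`.
      refine ⟨fun h => by rw [h, map_one], fun h => ?_⟩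
      rw [← he.apply_apply]
      exact hker _ h
  exact ⟨γ.trans δ⟩
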